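/- All rings are commutative with identity and nonzero. For a proper ideal $I$ of a Noetherian ring $R$, let $G(I)$ denote the grade of $I$, i.e. the common length of all maximal $R$-regular sequences contained in $I$, and let $\operatorname{ht}(I)$ denote its height. A Cohen–Macaulay ring is a Noetherian ring $R$ in which $G(\mathfrak m)=\operatorname{ht}(\mathfrak m)$ for every maximal ideal $\mathfrak m$ of $R$. Theorem 2.1. Let $k$ be a field and let $A$ and $B$ be $k$-algebras such that $A\otimes_k B$ is Noetherian. For ideals $I$ of $A$ and $J$ of $B$, let $I\otimes_k B+A\otimes_k J$ denote the ideal of $A\otimes_k B$ generated by the elements $a\otimes 1$ with $a\in I$ and $1\otimes b$ with $b\in J$. Then the following statements are equivalent: (i) $A\otimes_k B$ is a Cohen–Macaulay ring; (ii) $G(I\otimes_k B+A\otimes_k J)=\operatorname{ht}(I\otimes_k B+A\otimes_k J)$ for all proper ideals $I$ of $A$ and $J$ of $B$; (iii) $G(p\otimes_k B+A\otimes_k q)=\operatorname{ht}(p\otimes_k B+A\otimes_k q)$ for all prime ideals $p$ of $A$ and $q$ of $B$; (iv) $A$ and $B$ are both Cohen–Macaulay rings. -/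

import Mathlib

/-- The grade of an ideal `I`: the supremum, in `ℕ∞`, of the lengths of the regular sequences
of the ring `R` that consist of elements of `I`. For a proper ideal of a Noetherian ring this is
the common length of all maximal regular sequences in `I`, see
`Ideal.regularGrade_eq_length_of_maximal` and `Ideal.exists_maximal_regular`. -/
noncomputable def Ideal.regularGrade {R : Type*} [CommRing R] (I : Ideal R) : ℕ∞ :=
  ⨆ (rs : List R) (_ : ∀ r ∈ rs, r ∈ I) (_ : RingTheory.Sequence.IsRegular R rs),
    (rs.length : ℕ∞)

open RingTheory.Sequence CategoryTheory Abelian in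
/-- In a Noetherian ring, if an `M`-regular sequence `rs` in `I` cannot be extended within `I`,
then no `M`-regular sequence in `I` has length `rs.length + 1`. -/
theorem ModuleCat.no_longer_regular_of_maximal.{u} {R : Type u} [CommRing R] [IsNoetherianRing R]
    (I : Ideal R) (rs : List R) (M : ModuleCat.{u} R) [Module.Finite R M]
    (hM : I • (⊤ : Submodule R M) < ⊤) (hI : ∀ r ∈ rs, r ∈ I) (hreg : IsRegular M rs)
    (hmax : ∀ x ∈ I, ¬ IsRegular M (rs ++ [x])) (rs' : List R) (hI' : ∀ r ∈ rs', r ∈ I)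
    (hreg' : IsRegular M rs') : rs'.length ≠ rs.length + 1 := by
  intro hlen
  induction rs generalizing M rs' with
  | nil =>
    obtain ⟨x, rfl⟩ : ∃ x, rs' = [x] := List.length_eq_one_iff.mp (by simpa using hlen)
    exact hmax x (hI' x (by simp)) hreg'
  | cons a rs ih =>
    have hext : ∀ i < rs.length + 2, Subsingleton
        (Ext (ModuleCat.of R (Shrink.{u} (R ⧸ I))) M i) := by
      refine ((ModuleCat.exists_isRegular_tfae I (rs.length + 2) M hM).out 1 3).mpr ?_
      exact ⟨rs', by simpa using hlen, hI', hreg'⟩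
    have ha : a ∈ I := hI a (by simp)
    rw [isRegular_cons_iff] at hreg
    have hM' : I • (⊤ : Submodule R (QuotSMulTop a M)) < ⊤ := by
      refine lt_top_iff_ne_top.mpr fun eq ↦ hM.ne ?_
      have := congrArg (Submodule.comap (Submodule.mkQ _)) eq
      simpa [Submodule.comap_smul_top_of_surjective I _ (Submodule.mkQ_surjective _),
        Submodule.smul_mono_left ((Ideal.span_singleton_le_iff_mem I).mpr ha),
        ← Submodule.ideal_span_singleton_smul] using this
    have hext' : ∀ i < rs.length + 1, Subsingleton
        (Ext (ModuleCat.of R (Shrink.{u} (R ⧸ I))) (ModuleCat.of R (QuotSMulTop a M)) i) := by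
      intro i hi
      have zero1 := AddCommGrpCat.isZero_of_iff_subsingleton.mpr (hext i (by omega))
      have zero2 := AddCommGrpCat.isZero_of_iff_subsingleton.mpr (hext (i + 1) (by omega))
      exact AddCommGrpCat.subsingleton_of_isZero <| ShortComplex.Exact.isZero_of_both_zeros
        ((Ext.covariant_sequence_exact₃' _ hreg.1.smulShortComplex_shortExact) i (i + 1) rfl)
        (zero1.eq_zero_of_src _) (zero2.eq_zero_of_tgt _)
    obtain ⟨rs'', hlen'', hI'', hreg''⟩ := ((ModuleCat.exists_isRegular_tfae I (rs.length + 1)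
      (ModuleCat.of R (QuotSMulTop a M)) hM').out 1 3).mp hext'
    refine ih (ModuleCat.of R (QuotSMulTop a M)) hM' (fun r hr ↦ hI r (by simp [hr])) hreg.2
      (fun x hx h ↦ hmax x hx ?_) rs'' hI'' hreg'' hlen''
    rw [List.cons_append, isRegular_cons_iff]
    exact ⟨hreg.1, h⟩

open RingTheory.Sequence in
/-- In a Noetherian ring every maximal regular sequence in a proper ideal has length the grade. -/
theorem Ideal.regularGrade_eq_length_of_maximal.{u} {R : Type u} [CommRing R] [IsNoetherianRing R]
    (I : Ideal R) (hI : I ≠ ⊤) (rs : List R) (hrs : ∀ r ∈ rs, r ∈ I) (hreg : IsRegular R rs)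
    (hmax : ∀ x ∈ I, ¬ IsRegular R (rs ++ [x])) : I.regularGrade = rs.length := by
  apply le_antisymm
  · refine iSup_le fun rs' ↦ iSup_le fun hrs' ↦ iSup_le fun hreg' ↦ ?_
    by_contra! hlt
    have hlt' : rs.length + 1 ≤ rs'.length := by exact_mod_cast hlt
    have hM : I • (⊤ : Submodule R R) < ⊤ := by
      simpa [lt_top_iff_ne_top] using hI
    have hsub : ∀ r ∈ rs'.take (rs.length + 1), r ∈ I :=
      fun r hr ↦ hrs' r (List.mem_of_mem_take hr)
    refine ModuleCat.no_longer_regular_of_maximal I rs (ModuleCat.of R R) hM hrs hreg hmax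
      (rs'.take (rs.length + 1)) hsub ⟨?_, ?_⟩ (by simpa using hlt')
    · have h := hreg'.toIsWeaklyRegular
      rw [← List.take_append_drop (rs.length + 1) rs', isWeaklyRegular_append_iff] at h
      exact h.1
    · refine fun h ↦ hM.ne (top_le_iff.mp (h.le.trans (Submodule.smul_mono_left ?_)))
      exact Ideal.span_le.mpr hsub
  · exact le_iSup_of_le rs (le_iSup_of_le hrs (le_iSup_of_le hreg le_rfl))

open RingTheory.Sequence in
/-- In a Noetherian ring every proper ideal contains a maximal regular sequence. -/
theorem Ideal.exists_maximal_regular.{u} {R : Type u} [CommRing R] [IsNoetherianRing R]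
    (I : Ideal R) (hI : I ≠ ⊤) : ∃ rs : List R, (∀ r ∈ rs, r ∈ I) ∧ IsRegular R rs ∧
      ∀ x ∈ I, ¬ IsRegular R (rs ++ [x]) := by
  by_contra! h
  have : Nontrivial R := by
    by_contra h'
    rw [not_nontrivial_iff_subsingleton] at h'
    exact hI (Subsingleton.elim _ _)
  choose! f hf hf' using h
  let s : ℕ → List R := fun n ↦ n.rec [] fun _ l ↦ l ++ [f l]
  have hs : ∀ n, (∀ r ∈ s n, r ∈ I) ∧ IsRegular R (s n) := by
    intro n
    induction n with
    | zero => exact ⟨by simp [s], IsRegular.nil R R⟩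
    | succ n ih =>
      refine ⟨fun r hr ↦ ?_, hf' _ ih.1 ih.2⟩
      rcases List.mem_append.mp hr with hr | hr
      · exact ih.1 r hr
      · rw [List.mem_singleton.mp hr]
        exact hf _ ih.1 ih.2
  have hmono : StrictMono fun n ↦ Ideal.ofList (s n) := by
    refine strictMono_nat_of_lt_succ fun n ↦ ?_
    have hsn : s (n + 1) = s n ++ [f (s n)] := rfl
    have key := (hs (n + 1)).2.toIsWeaklyRegular
    rw [hsn, isWeaklyRegular_append_iff, isWeaklyRegular_singleton_iff] at key
    change Ideal.ofList (s n) < Ideal.ofList (s (n + 1))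
    refine lt_of_le_of_ne (by rw [hsn, Ideal.ofList_append]; exact le_sup_left) fun heq ↦ ?_
    have hmem : f (s n) ∈ Ideal.ofList (s n) := by
      rw [heq]
      exact Ideal.subset_span (by simp [hsn])
    have h1 : (Submodule.Quotient.mk 1 :
        R ⧸ (Ideal.ofList (s n) • ⊤ : Submodule R R)) = 0 := by
      apply key.2
      change f (s n) • (Submodule.Quotient.mk 1 :
        R ⧸ (Ideal.ofList (s n) • ⊤ : Submodule R R)) =
        f (s n) • (0 : R ⧸ (Ideal.ofList (s n) • ⊤ : Submodule R R))
      rw [smul_zero, ← Submodule.Quotient.mk_smul, Submodule.Quotient.mk_eq_zero]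
      exact Submodule.smul_mem_smul hmem trivial
    rw [Submodule.Quotient.mk_eq_zero] at h1
    exact (hs n).2.top_ne_smul (((Ideal.eq_top_iff_one _).mpr h1).symm)
  obtain ⟨n, hn⟩ := monotone_stabilizes_iff_noetherian.mpr (inferInstanceAs (IsNoetherian R R))
    ⟨_, hmono.monotone⟩
  exact (hmono (Nat.lt_succ_self n)).ne (hn (n + 1) (by omega))

/-- A Cohen-Macaulay ring is a Noetherian ring in which the grade of every maximal ideal equals
its height. -/
structure IsCohenMacaulayRing (R : Type*) [CommRing R] : Prop where
  isNoetherianRing : IsNoetherianRing R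
  grade_eq_height : ∀ m : Ideal R, m.IsMaximal → m.regularGrade = m.height

/-- The ideal `I ⊗ B + A ⊗ J` of `A ⊗[k] B`: the sum of the extensions of `I` and `J`
along the canonical maps `a ↦ a ⊗ 1` and `b ↦ 1 ⊗ b`. -/
def Ideal.tensorSum (k : Type*) {A B : Type*} [CommRing k] [CommRing A] [CommRing B]
    [Algebra k A] [Algebra k B] (I : Ideal A) (J : Ideal B) : Ideal (TensorProduct k A B) :=
  I.map (Algebra.TensorProduct.includeLeft : A →ₐ[k] TensorProduct k A B) ⊔
    J.map (Algebra.TensorProduct.includeRight : B →ₐ[k] TensorProduct k A B)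

/-!
The condition "grade = height" for the ideals `I ⊗ B + A ⊗ J` separates into one condition on `A`
and one on `B`, because the grade is additive, `Ideal.regularGrade_tensorSum`, and the height is
superadditive, `Ideal.height_add_height_le_height_tensorSum`. Since the grade never exceeds the
height (`Ideal.regularGrade_le_height`) and heights are finite, equality for `p ⊗ B + A ⊗ q` with
`p` and `q` maximal forces `G(p) = ht p` and `G(q) = ht q`.

Both this bound on the grade and the fact that grade and height agree for all proper ideals of a
Cohen-Macaulay ring (`IsCohenMacaulayRing.regularGrade_eq_height`) come from one statement about
associated primes, `IsAssociatedPrime.height_add_length_le`: if `P` is an associated prime of `M`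
and a prime `Q` containing `P` contains an `M`-regular sequence of length `n`, then
`ht P + n ≤ ht Q`.

That `A ⊗ B` is Cohen-Macaulay when `A` and `B` are is proved along the flat map `A → A ⊗ B`, whose
fibres are the rings `κ(p) ⊗ B`. A Noetherian flat algebra over a Cohen-Macaulay ring with
Cohen-Macaulay fibres is Cohen-Macaulay (`IsCohenMacaulayRing.of_flat_of_fiber`): after localizing
at `p`, a regular sequence of length `ht p` makes `p` nilpotent, and a sequence that is regular on
the fibre remains weakly regular on everything that is an iterated extension of copies of the fibre.

It remains to see that `K ⊗ B` is Cohen-Macaulay for every field extension `K` of `k` for which it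
is Noetherian (`IsCohenMacaulayRing.tensorProduct_field`). The extension `K` need not be finitely
generated, but a maximal ideal `Q` of `K ⊗ B` is a finitely generated ideal, and by Noether
normalization its generators are integral over a polynomial ring `B[X₁, …, Xₙ]` over which `K ⊗ B`
is flat. So `Q` is minimal over the extension of its contraction `N` to that Cohen-Macaulay ring,
whence `ht Q ≤ ht N = G(N) ≤ G(Q)`.
-/

section

open RingTheory.Sequence TensorProduct

/-! ### Associated primes, regular sequences and heights -/


namespace IsAssociatedPrime

variable {R M : Type*} [CommRing R] [IsNoetherianRing R] [AddCommGroup M] [Module R M]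
  [Module.Finite R M]

/-- If `P = ann z` is an associated prime of `M` and `x` is `M`-regular, then among the elements
killed by `P` there is one whose class in `M / xM` does not vanish in the localization at a given
prime `Q` containing `P` and `x`: otherwise the submodule `N` of elements killed by `P` satisfies
`N_Q = x N_Q`, which contradicts Nakayama's lemma, here in the form of the determinant trick. -/
theorem exists_smul_eq_zero_and_smul_notMem {P Q : Ideal R} [hQ : Q.IsPrime]
    (hP : IsAssociatedPrime P M) (hPQ : P ≤ Q) {x : R} (hxQ : x ∈ Q) (hx : IsSMulRegular M x) :
    ∃ z : M, (∀ p ∈ P, p • z = 0) ∧ ∀ s ∉ Q, ∀ y : M, s • z ≠ x • y := by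
  by_contra! hcon
  let N : Submodule R M := Submodule.torsionBySet R M P
  have hN : ∀ z : M, z ∈ N ↔ ∀ p ∈ P, p • z = 0 := fun z ↦ by
    simp [N, Submodule.mem_torsionBySet_iff]
  obtain ⟨hPp, z₀, hz₀⟩ := isAssociatedPrime_iff.mp hP
  have hz₀' : ∀ r, r ∈ P ↔ r • z₀ = 0 := fun r ↦ by
    rw [hz₀, Submodule.mem_colon_singleton, Submodule.mem_bot]
  have hz₀N : z₀ ∈ N := (hN _).mpr fun p hp ↦ (hz₀' p).mp hp
  -- a single `t ∉ Q` multiplies all of `N` into `xM`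
  obtain ⟨t, htQ, ht⟩ : ∃ t ∉ Q, ∀ z ∈ N, ∃ y, t • z = x • y := by
    obtain ⟨S, hS⟩ := (IsNoetherian.noetherian N : N.FG)
    choose! s hs y hy using fun z (hz : z ∈ N) ↦ hcon z ((hN z).mp hz)
    refine ⟨∏ z ∈ S, s z, fun h ↦ ?_, fun z hz ↦ ?_⟩
    · obtain ⟨z, hzS, hz⟩ := (Ideal.IsPrime.prod_mem_iff).mp h
      exact hs z (hS ▸ Submodule.subset_span hzS) hz
    · suffices h : N ≤ (LinearMap.range (LinearMap.lsmul R M x)).comap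
          (LinearMap.lsmul R M (∏ z ∈ S, s z)) by
        obtain ⟨y, hy⟩ := h hz
        exact ⟨y, hy.symm⟩
      rw [← hS, Submodule.span_le]
      intro w hw
      obtain ⟨c, hc⟩ := Finset.dvd_prod_of_mem s hw
      refine ⟨c • y w, ?_⟩
      have := hy w (hS ▸ Submodule.subset_span hw)
      simp only [LinearMap.lsmul_apply, hc]
      rw [mul_comm, mul_smul, this, smul_comm]
  let φ : Module.End R N := algebraMap R _ t
  have hφ : LinearMap.range φ ≤ Ideal.span {x} • ⊤ := by
    rintro _ ⟨⟨z, hz⟩, rfl⟩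
    obtain ⟨y, hy⟩ := ht z hz
    have hyN : y ∈ N := (hN y).mpr fun p hp ↦ hx <| by
      simp only [smul_zero]
      rw [smul_comm, ← hy, smul_comm, (hN z).mp hz p hp, smul_zero]
    have : φ ⟨z, hz⟩ = x • (⟨y, hyN⟩ : N) := Subtype.ext hy
    rw [this]
    exact Submodule.smul_mem_smul (Ideal.mem_span_singleton_self x) trivial
  obtain ⟨p, hp, -, hcoeff, hzero⟩ :=
    LinearMap.exists_monic_and_natDegree_eq_and_coeff_mem_pow_and_aeval_eq_zero R φ _ hφ
  have heval : p.eval t ∈ P := by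
    rw [hz₀']
    have h1 := congrArg (fun f : Module.End R N ↦ ((f ⟨z₀, hz₀N⟩ : N) : M)) hzero
    simpa [φ, Polynomial.aeval_algebraMap_apply] using h1
  have hmem : t ^ p.natDegree ∈ Q := by
    have h2 := hPQ heval
    rw [Polynomial.eval_eq_sum_range, Finset.sum_range_succ, hp.coeff_natDegree, one_mul] at h2
    refine (Q.add_mem_iff_right (Q.sum_mem fun k hk ↦ ?_)).mp h2
    have hk' : p.natDegree - k ≠ 0 := by
      have := Finset.mem_range.mp hk
      omega
    refine Q.mul_mem_right _ ?_
    exact (Ideal.span_singleton_le_iff_mem Q).mpr hxQ (Ideal.pow_le_self hk' (hcoeff k))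
  exact htQ (hQ.mem_of_pow_mem _ hmem)

/-- An associated prime of `M` inside a prime `Q` can be strictly enlarged, inside `Q`, to an
associated prime of `M / xM`, for an `M`-regular element `x` of `Q`. -/
theorem exists_lt_quotSMulTop {P Q : Ideal R} [hQ : Q.IsPrime]
    (hP : IsAssociatedPrime P M) (hPQ : P ≤ Q) {x : R} (hxQ : x ∈ Q) (hx : IsSMulRegular M x) :
    ∃ P' : Ideal R, IsAssociatedPrime P' (QuotSMulTop x M) ∧ P < P' ∧ P' ≤ Q := by
  obtain ⟨z, hPz, hz⟩ := hP.exists_smul_eq_zero_and_smul_notMem hPQ hxQ hx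
  obtain ⟨-, z₀, hz₀⟩ := isAssociatedPrime_iff.mp hP
  let w : QuotSMulTop x M := Submodule.Quotient.mk z
  have hcolon : (⊥ : Submodule R (QuotSMulTop x M)).colon {w} ≤ Q := by
    intro s hs
    by_contra hsQ
    rw [Submodule.mem_colon_singleton, Submodule.mem_bot, ← Submodule.Quotient.mk_smul,
      Submodule.Quotient.mk_eq_zero] at hs
    obtain ⟨y, -, hy⟩ := (Submodule.mem_smul_pointwise_iff_exists _ _ _).mp hs
    exact hz s hsQ y hy.symm
  obtain ⟨P', hP', hP'Q⟩ := Ideal.exists_minimalPrimes_le hcolon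
  have hass : IsAssociatedPrime P' (QuotSMulTop x M) := by
    rw [isAssociatedPrime_iff]
    exact ⟨hP'.1.1, Submodule.exists_eq_colon_of_mem_minimalPrimes hP'⟩
  have hle : ∀ r, r • w = 0 → r ∈ P' := fun r hr ↦ hP'.1.2 <| by
    rwa [Submodule.mem_colon_singleton, Submodule.mem_bot]
  have hxP' : x ∈ P' := hle x <| by
    rw [← Submodule.Quotient.mk_smul, Submodule.Quotient.mk_eq_zero]
    exact Submodule.smul_mem_pointwise_smul _ _ _ trivial
  refine ⟨P', hass, lt_of_le_of_ne (fun p hp ↦ hle p ?_) ?_, hP'Q⟩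
  · rw [← Submodule.Quotient.mk_smul, hPz p hp, Submodule.Quotient.mk_zero]
  · rintro rfl
    have hz₀0 : z₀ = 0 := hx <| by
      rw [hz₀, Submodule.mem_colon_singleton, Submodule.mem_bot] at hxP'
      simpa using hxP'
    rw [hz₀0] at hz₀
    exact hP'.1.1.ne_top (by rw [hz₀]; simp)

/-- A regular sequence of length `n` in a prime `Q` produces a chain of `n` strict inclusions of
primes between any associated prime contained in `Q` and `Q`. -/
theorem height_add_length_le {P Q : Ideal R} [hQ : Q.IsPrime]
    (hP : IsAssociatedPrime P M) (hPQ : P ≤ Q) {rs : List R} (hrs : ∀ r ∈ rs, r ∈ Q)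
    (hreg : IsWeaklyRegular M rs) : P.height + rs.length ≤ Q.height := by
  induction rs generalizing M P with
  | nil => simpa using Ideal.height_mono hPQ
  | cons x rs ih =>
    rw [isWeaklyRegular_cons_iff] at hreg
    obtain ⟨P', hP', hlt, hle⟩ := hP.exists_lt_quotSMulTop hPQ (hrs x (by simp)) hreg.1
    have := ih hP' hle (fun r hr ↦ hrs r (by simp [hr])) hreg.2
    have := hP.isPrime
    have := hP'.isPrime
    calc P.height + ((x :: rs).length : ℕ∞) = P.height + 1 + rs.length := by
          rw [List.length_cons]; push_cast; ring
      _ ≤ P'.height + rs.length := by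
          gcongr; exact Ideal.height_add_one_le_of_lt_of_isPrime hlt
      _ ≤ Q.height := by assumption

end IsAssociatedPrime

/-! ### The grade of an ideal -/

namespace RingTheory.Sequence

variable {R : Type*} [CommRing R]

theorem IsWeaklyRegular.isRegular_of_mem {I : Ideal R} (hI : I ≠ ⊤) {rs : List R}
    (hrs : ∀ r ∈ rs, r ∈ I) (hreg : IsWeaklyRegular R rs) : IsRegular R rs := by
  refine ⟨hreg, fun h ↦ hI ?_⟩
  rw [smul_eq_mul, Ideal.mul_top] at h
  exact top_le_iff.mp (h.le.trans (Ideal.span_le.mpr hrs))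

theorem isSMulRegular_quotient_ofList_iff {rs : List R} {x : R} :
    IsSMulRegular (R ⧸ (Ideal.ofList rs • ⊤ : Submodule R R)) x ↔
      ∀ y, x * y ∈ Ideal.ofList rs → y ∈ Ideal.ofList rs := by
  rw [isSMulRegular_iff_right_eq_zero_of_smul, (Submodule.Quotient.mk_surjective _).forall]
  refine forall_congr' fun y ↦ ?_
  rw [← Submodule.Quotient.mk_smul, Submodule.Quotient.mk_eq_zero, Submodule.Quotient.mk_eq_zero,
    smul_eq_mul, smul_eq_mul, Ideal.mul_top]

theorem IsWeaklyRegular.length_le_height [IsNoetherianRing R] {I : Ideal R} {rs : List R}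
    (hrs : ∀ r ∈ rs, r ∈ I) (hreg : IsWeaklyRegular R rs) : (rs.length : ℕ∞) ≤ I.height := by
  rw [Ideal.height_eq_inf_minimalPrimes]
  refine le_iInf₂ fun Q hQ ↦ ?_
  have := hQ.1.1
  have : Nontrivial R := ⟨0, 1, fun h ↦ this.ne_top ((Ideal.eq_top_iff_one _).mpr (h ▸ Q.zero_mem))⟩
  obtain ⟨P, hP, hPQ⟩ := Ideal.exists_minimalPrimes_le (bot_le : ⊥ ≤ Q)
  have hass : IsAssociatedPrime P R := by
    refine Module.associatedPrimes.minimalPrimes_annihilator_subset_associatedPrimes R R ?_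
    rwa [(Module.annihilator_eq_bot (R := R) (M := R)).mpr inferInstance]
  exact le_add_self.trans (hass.height_add_length_le hPQ (fun r hr ↦ hQ.1.2 (hrs r hr)) hreg)

end RingTheory.Sequence

namespace Ideal

variable {R : Type*} [CommRing R]

theorem length_le_regularGrade {I : Ideal R} (hI : I ≠ ⊤) {rs : List R} (hrs : ∀ r ∈ rs, r ∈ I)
    (hreg : IsWeaklyRegular R rs) : (rs.length : ℕ∞) ≤ I.regularGrade :=
  le_iSup_of_le rs (le_iSup_of_le hrs (le_iSup_of_le (hreg.isRegular_of_mem hI hrs) le_rfl))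

variable [IsNoetherianRing R]

theorem regularGrade_le_height (I : Ideal R) : I.regularGrade ≤ I.height :=
  iSup_le fun _ ↦ iSup_le fun hrs ↦ iSup_le fun hreg ↦ hreg.toIsWeaklyRegular.length_le_height hrs

/-- Every regular sequence in a proper ideal extends to a maximal one, since the height of the
ideal bounds the lengths. -/
theorem exists_maximal_append {I : Ideal R} (hI : I ≠ ⊤) {rs : List R} (hrs : ∀ r ∈ rs, r ∈ I)
    (hreg : IsWeaklyRegular R rs) : ∃ rs' : List R, (∀ r ∈ rs ++ rs', r ∈ I) ∧
      IsRegular R (rs ++ rs') ∧ ∀ x ∈ I, ¬ IsRegular R (rs ++ rs' ++ [x]) := by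
  by_contra! h
  have key : ∀ n : ℕ, ∃ rs' : List R, (∀ r ∈ rs ++ rs', r ∈ I) ∧ IsRegular R (rs ++ rs') ∧
      rs'.length = n := by
    intro n
    induction n with
    | zero => exact ⟨[], by simpa using hrs, by simpa using hreg.isRegular_of_mem hI hrs, rfl⟩
    | succ n ih =>
      obtain ⟨rs', h1, h2, h3⟩ := ih
      obtain ⟨x, hx, hx'⟩ := h rs' h1 h2
      refine ⟨rs' ++ [x], fun r hr ↦ ?_, by rwa [← List.append_assoc], by simp [h3]⟩
      rw [← List.append_assoc, List.mem_append, List.mem_singleton] at hr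
      rcases hr with hr | rfl
      exacts [h1 r hr, hx]
  obtain ⟨n, hn⟩ := ENat.ne_top_iff_exists.mp (Ideal.height_ne_top hI)
  obtain ⟨rs', h1, h2, h3⟩ := key (n + 1)
  have := h2.toIsWeaklyRegular.length_le_height h1
  rw [← hn, List.length_append, h3] at this
  norm_cast at this
  omega

/-- A regular sequence `rs` in `I` that cannot be extended within `I` has an associated prime
containing `I`: by prime avoidance, as `I` consists of zero divisors modulo `rs`. -/
theorem exists_isAssociatedPrime_of_maximal {I : Ideal R} (hI : I ≠ ⊤) {rs : List R}
    (hrs : ∀ r ∈ rs, r ∈ I) (hreg : IsWeaklyRegular R rs)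
    (hmax : ∀ x ∈ I, ¬ IsRegular R (rs ++ [x])) :
    ∃ P : Ideal R, IsAssociatedPrime P (R ⧸ (Ideal.ofList rs • ⊤ : Submodule R R)) ∧ I ≤ P := by
  obtain ⟨P, hP, hIP⟩ := (I.subset_union_prime_finite (associatedPrimes.finite R
    (R ⧸ (Ideal.ofList rs • ⊤ : Submodule R R))) (f := id) 0 0 fun _ h _ _ ↦ h.isPrime).1 <| by
      simp_rw [id, biUnion_associatedPrimes_eq_zero_divisors]
      intro x hx
      by_contra hcon
      refine hmax x hx (IsWeaklyRegular.isRegular_of_mem hI (fun r hr ↦ ?_) ?_)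
      · rcases List.mem_append.mp hr with hr | hr
        exacts [hrs r hr, List.mem_singleton.mp hr ▸ hx]
      · rw [isWeaklyRegular_append_iff, isWeaklyRegular_singleton_iff,
          isSMulRegular_iff_right_eq_zero_of_smul]
        exact ⟨hreg, fun z hz ↦ by_contra fun hz0 ↦ hcon ⟨z, hz0, hz⟩⟩
  exact ⟨P, hP, hIP⟩

theorem exists_notMem_ofList_of_maximal {I : Ideal R} (hI : I ≠ ⊤) {rs : List R}
    (hrs : ∀ r ∈ rs, r ∈ I) (hreg : IsWeaklyRegular R rs)
    (hmax : ∀ x ∈ I, ¬ IsRegular R (rs ++ [x])) :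
    ∃ y ∉ Ideal.ofList rs, ∀ x ∈ I, x * y ∈ Ideal.ofList rs := by
  obtain ⟨P, hP, hIP⟩ := exists_isAssociatedPrime_of_maximal hI hrs hreg hmax
  obtain ⟨hPp, y, hy⟩ := isAssociatedPrime_iff.mp hP
  obtain ⟨y, rfl⟩ := Submodule.Quotient.mk_surjective _ y
  have hy' : ∀ r, r ∈ P ↔ r * y ∈ Ideal.ofList rs := fun r ↦ by
    rw [hy, Submodule.mem_colon_singleton, Submodule.mem_bot, ← Submodule.Quotient.mk_smul,
      Submodule.Quotient.mk_eq_zero]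
    simp
  refine ⟨y, fun h ↦ hPp.ne_top ((Ideal.eq_top_iff_one _).mpr ((hy' 1).mpr (by simpa))), ?_⟩
  exact fun x hx ↦ (hy' x).mp (hIP hx)

theorem regularGrade_eq_length_of_notMem_ofList {I : Ideal R} (hI : I ≠ ⊤) {rs : List R}
    (hrs : ∀ r ∈ rs, r ∈ I) (hreg : IsWeaklyRegular R rs) {y : R} (hy : y ∉ Ideal.ofList rs)
    (hIy : ∀ x ∈ I, x * y ∈ Ideal.ofList rs) : I.regularGrade = rs.length := by
  refine I.regularGrade_eq_length_of_maximal hI rs hrs (hreg.isRegular_of_mem hI hrs)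
    fun x hx h ↦ hy ?_
  have := h.toIsWeaklyRegular
  rw [isWeaklyRegular_append_iff, isWeaklyRegular_singleton_iff,
    isSMulRegular_quotient_ofList_iff] at this
  exact this.2 y (hIy x hx)

/-- In a proper ideal of a Noetherian ring some regular sequence has length the grade, and a
nonzero class modulo that sequence is killed by the ideal. -/
theorem exists_isWeaklyRegular_length_eq_regularGrade {I : Ideal R} (hI : I ≠ ⊤) :
    ∃ rs : List R, (∀ r ∈ rs, r ∈ I) ∧ IsWeaklyRegular R rs ∧ (rs.length : ℕ∞) = I.regularGrade ∧
      ∃ y ∉ Ideal.ofList rs, ∀ x ∈ I, x * y ∈ Ideal.ofList rs := by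
  obtain ⟨rs, hrs, hreg, hmax⟩ := I.exists_maximal_regular hI
  exact ⟨rs, hrs, hreg.toIsWeaklyRegular,
    (I.regularGrade_eq_length_of_maximal hI rs hrs hreg hmax).symm,
    exists_notMem_ofList_of_maximal hI hrs hreg.toIsWeaklyRegular hmax⟩

end Ideal

/-! ### Cohen-Macaulay rings -/

namespace IsCohenMacaulayRing

variable {R : Type*} [CommRing R]

theorem of_height_le [IsNoetherianRing R]
    (h : ∀ m : Ideal R, m.IsMaximal → m.height ≤ m.regularGrade) : IsCohenMacaulayRing R :=
  ⟨inferInstance, fun m hm ↦ le_antisymm m.regularGrade_le_height (h m hm)⟩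

/-- In a Cohen-Macaulay ring the grade of every proper ideal is its height. Let `rs` be a maximal
regular sequence in `I` and `P` an associated prime of `R / (rs)` containing `I`. Extending `rs`
to a maximal regular sequence in a maximal ideal `m` containing `P`, the extension has length
`ht m`, and the chain of primes between `P` and `m` that it gives forces `ht P ≤ rs.length`. -/
theorem regularGrade_eq_height (hR : IsCohenMacaulayRing R) {I : Ideal R} (hI : I ≠ ⊤) :
    I.regularGrade = I.height := by
  have := hR.isNoetherianRing
  refine le_antisymm I.regularGrade_le_height ?_
  obtain ⟨rs, hrs, hreg, hmax⟩ := I.exists_maximal_regular hI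
  rw [I.regularGrade_eq_length_of_maximal hI rs hrs hreg hmax]
  obtain ⟨P, hP, hIP⟩ := Ideal.exists_isAssociatedPrime_of_maximal hI hrs hreg.1 hmax
  have := hP.isPrime
  obtain ⟨m, hm, hPm⟩ := P.exists_le_maximal this.ne_top
  obtain ⟨rs', hrs', hreg', hmax'⟩ := Ideal.exists_maximal_append hm.ne_top
    (fun r hr ↦ hPm (hIP (hrs r hr))) hreg.1
  have hlen := m.regularGrade_eq_length_of_maximal hm.ne_top _ hrs' hreg' hmax'
  rw [hR.grade_eq_height m hm] at hlen
  have h1 := hP.height_add_length_le hPm (fun r hr ↦ hrs' r (List.mem_append_right _ hr))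
    ((isWeaklyRegular_append_iff ..).mp hreg'.1).2
  rw [hlen, List.length_append] at h1
  push_cast at h1
  exact (Ideal.height_mono hIP).trans ((ENat.add_le_add_iff_right (ENat.natCast_ne_top _)).mp h1)

theorem exists_isWeaklyRegular_length_eq_height (hR : IsCohenMacaulayRing R) {I : Ideal R}
    (hI : I ≠ ⊤) : ∃ rs : List R, (∀ r ∈ rs, r ∈ I) ∧ IsWeaklyRegular R rs ∧
      (rs.length : ℕ∞) = I.height := by
  have := hR.isNoetherianRing
  obtain ⟨rs, h1, h2, h3, -⟩ := Ideal.exists_isWeaklyRegular_length_eq_regularGrade hI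
  exact ⟨rs, h1, h2, h3.trans (hR.regularGrade_eq_height hI)⟩

end IsCohenMacaulayRing

/-! ### Weakly regular sequences and exact sequences -/

namespace RingTheory.Sequence

theorem IsWeaklyRegular.of_exact {R M₁ M₂ M₃ : Type*} [CommRing R] [AddCommGroup M₁] [Module R M₁]
    [AddCommGroup M₂] [Module R M₂] [AddCommGroup M₃] [Module R M₃] {f : M₁ →ₗ[R] M₂}
    {g : M₂ →ₗ[R] M₃} (hf : Function.Injective f) (hg : Function.Surjective g)
    (hfg : Function.Exact f g) {rs : List R} (h₁ : IsWeaklyRegular M₁ rs)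
    (h₃ : IsWeaklyRegular M₃ rs) : IsWeaklyRegular M₂ rs := by
  induction rs generalizing M₁ M₂ M₃ with
  | nil => exact .nil R M₂
  | cons r rs ih =>
    rw [isWeaklyRegular_cons_iff] at h₁ h₃ ⊢
    constructor
    · rw [isSMulRegular_iff_right_eq_zero_of_smul]
      intro z hz
      have hgz : g z = 0 := h₃.1.right_eq_zero_of_smul (by rw [← map_smul, hz, map_zero])
      obtain ⟨w, rfl⟩ := (hfg z).mp hgz
      have : w = 0 := h₁.1.right_eq_zero_of_smul (hf (by rw [map_smul, hz, map_zero]))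
      rw [this, map_zero]
    · refine ih (f := QuotSMulTop.map r f) (g := QuotSMulTop.map r g) ?_
        (QuotSMulTop.map_surjective r hg) (QuotSMulTop.map_exact r hfg hg) h₁.2 h₃.2
      have h0 : Function.Exact (0 : M₁ →ₗ[R] M₁) f :=
        (LinearMap.exact_zero_iff_injective M₁ f).mpr hf
      have := QuotSMulTop.map_first_exact_on_four_term_exact_of_isSMulRegular_last h0 hfg h₃.1
      rw [injective_iff_map_eq_zero]
      intro x hx
      obtain ⟨w, rfl⟩ := (this x).mp hx
      obtain ⟨w, rfl⟩ := Submodule.Quotient.mk_surjective _ w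
      rw [QuotSMulTop.map_apply_mk, LinearMap.zero_apply, Submodule.Quotient.mk_zero]

theorem IsWeaklyRegular.of_subsingleton {R M : Type*} [CommRing R] [AddCommGroup M] [Module R M]
    [Subsingleton M] (rs : List R) : IsWeaklyRegular M rs :=
  ⟨fun _ _ _ _ _ ↦ Subsingleton.elim _ _⟩

/-- A sequence that is weakly regular on the fibre `S / pS` of a flat algebra over a maximal ideal
`p` is weakly regular on `S ⊗ E` for every finitely generated module `E` killed by a power of `p`,
since `E` is an iterated extension of copies of `R / p`. -/
theorem IsWeaklyRegular.tensor_of_pow_le_annihilator {R S E : Type*} [CommRing R]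
    [IsNoetherianRing R] [CommRing S] [Algebra R S] [Module.Flat R S] {p : Ideal R}
    [hp : p.IsMaximal] {ys : List S} (hys : IsWeaklyRegular (S ⧸ p.map (algebraMap R S)) ys)
    [AddCommGroup E] [Module R E] [hE : Module.Finite R E] {n : ℕ}
    (hn : p ^ n ≤ Module.annihilator R E) : IsWeaklyRegular (S ⊗[R] E) ys := by
  induction hE using IsNoetherianRing.induction_on_isQuotientEquivQuotientPrime R with
  | subsingleton N => exact .of_subsingleton ys
  | quotient N P e =>
    have hP : P.1 = p := by
      refine (hp.eq_of_le P.2.ne_top (P.2.le_of_pow_le (n := n) fun r hr ↦ ?_)).symm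
      have := Module.mem_annihilator.mp (hn hr) (e.symm 1)
      rw [← map_smul, LinearEquiv.map_eq_zero_iff] at this
      rwa [← Ideal.Quotient.eq_zero_iff_mem, ← mul_one (Ideal.Quotient.mk _ r)]
    have e' : (S ⊗[R] N) ≃ₗ[S] S ⧸ p.map (algebraMap R S) :=
      (TensorProduct.AlgebraTensorModule.congr (LinearEquiv.refl S S) (hP ▸ e)).trans
        (Algebra.TensorProduct.quotIdealMapEquivTensorQuot S p).symm.toLinearEquiv
    exact (e'.isWeaklyRegular_congr ys).mpr hys
  | exact N₁ N₂ N₃ f g hf hg hfg h₁ h₃ =>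
    refine .of_exact (f := f.baseChange S) (g := g.baseChange S) ?_ ?_ ?_ (h₁ ?_) (h₃ ?_)
    · exact Module.Flat.lTensor_preserves_injective_linearMap f hf
    · exact LinearMap.lTensor_surjective S hg
    · exact lTensor_exact S hfg hg
    · exact hn.trans (LinearMap.annihilator_le_of_injective f hf)
    · exact hn.trans (LinearMap.annihilator_le_of_surjective g hg)

end RingTheory.Sequence

/-! ### Permanence properties of the Cohen-Macaulay condition -/

namespace IsCohenMacaulayRing

theorem of_ringEquiv {R S : Type*} [CommRing R] [CommRing S] (hR : IsCohenMacaulayRing R)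
    (e : R ≃+* S) : IsCohenMacaulayRing S := by
  have := hR.isNoetherianRing
  have := isNoetherianRing_of_ringEquiv R e
  refine of_height_le fun m hm ↦ ?_
  have hm' : (m.comap e).IsMaximal := Ideal.comap_isMaximal_of_equiv e
  obtain ⟨rs, hrs, hreg, hlen⟩ := hR.exists_isWeaklyRegular_length_eq_height hm'.ne_top
  have hreg' : IsWeaklyRegular S (rs.map e) := by
    refine (e.toAddEquiv.isWeaklyRegular_congr ?_).mp hreg
    rw [List.forall₂_map_right_iff, List.forall₂_same]
    exact fun r _ x ↦ map_mul e r x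
  have := Ideal.length_le_regularGrade hm.ne_top (by simpa using hrs) hreg'
  rwa [List.length_map, hlen, e.height_comap] at this

end IsCohenMacaulayRing

/-- Localization does not change the grade of a maximal ideal that survives. -/
theorem IsLocalization.regularGrade_under {R S : Type*} [CommRing R] [IsNoetherianRing R]
    [CommRing S] [Algebra R S] (W : Submonoid R) [IsLocalization W S] (Q : Ideal S) (hQ : Q ≠ ⊤)
    [hm : (Q.under R).IsMaximal] : (Q.under R).regularGrade = Q.regularGrade := by
  have := IsLocalization.isNoetherianRing W S inferInstance
  obtain ⟨rs, hrs, hreg, hlen, y, hy, hmy⟩ :=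
    Ideal.exists_isWeaklyRegular_length_eq_regularGrade hm.ne_top
  have hcolon : ∀ w : R, w * y ∈ Ideal.ofList rs → w ∈ Q.under R := by
    intro w hw
    by_contra hwQ
    obtain ⟨a, b, hb, hab⟩ := Ideal.IsMaximal.exists_inv hm hwQ
    apply hy
    have : y = a * (w * y) + b * y := by linear_combination y * hab.symm
    rw [this]
    exact add_mem (Ideal.mul_mem_left _ _ hw) (hmy b hb)
  have hle : ∀ x ∈ Q, x * algebraMap R S y ∈ (Ideal.ofList rs).map (algebraMap R S) := by
    suffices h : Q ≤ ((Ideal.ofList rs).map (algebraMap R S)).colon {algebraMap R S y} from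
      fun x hx ↦ Submodule.mem_colon_singleton.mp (h hx)
    rw [← IsLocalization.map_under W S Q, Ideal.map_le_iff_le_comap]
    intro x hx
    rw [Ideal.mem_comap, Submodule.mem_colon_singleton, smul_eq_mul, ← map_mul]
    exact Ideal.mem_map_of_mem _ (hmy x hx)
  rw [← hlen, Ideal.regularGrade_eq_length_of_notMem_ofList hQ (rs := rs.map (algebraMap R S))
    (by simpa using hrs) (hreg.of_isLocalization S W) (y := algebraMap R S y) ?_ ?_,
    List.length_map]
  · rw [← Ideal.map_ofList, IsLocalization.algebraMap_mem_map_algebraMap_iff W]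
    rintro ⟨w, hw, hwy⟩
    exact hQ (Q.eq_top_of_isUnit_mem (hcolon w hwy) (IsLocalization.map_units S ⟨w, hw⟩))
  · rwa [← Ideal.map_ofList]

/-- Let `p` be the maximal ideal of `R`. Weakly regular sequences in `p` and in the fibre `S / pS`
combine to one in `Q`: if `rs ⊆ p` is weakly regular of length `ht p`, then `p` is nilpotent modulo
`rs`, so that a sequence that is weakly regular on the fibre stays so on `S / (rs)`. -/
theorem Ideal.height_le_regularGrade_of_flat_of_isLocalRing {R S : Type*} [CommRing R]
    [IsLocalRing R] [CommRing S] [IsNoetherianRing S] [Algebra R S] [Module.Flat R S]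
    (hR : IsCohenMacaulayRing R)
    (hF : IsCohenMacaulayRing (S ⧸ (IsLocalRing.maximalIdeal R).map (algebraMap R S)))
    (Q : Ideal S) [hQ : Q.IsPrime] [Q.LiesOver (IsLocalRing.maximalIdeal R)] :
    Q.height ≤ Q.regularGrade := by
  have := hR.isNoetherianRing
  set p := IsLocalRing.maximalIdeal R
  have hpQ : p.map (algebraMap R S) ≤ Q := by
    rw [Ideal.map_le_iff_le_comap, Ideal.LiesOver.over (p := p) (P := Q)]
  set π := Ideal.Quotient.mk (p.map (algebraMap R S))
  obtain ⟨rs, hrs, hreg, hlen⟩ :=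
    hR.exists_isWeaklyRegular_length_eq_height (I := p) Ideal.IsPrime.ne_top'
  have hQ' : (Q.map π).IsPrime := Ideal.isPrime_map_quotientMk_of_isPrime hpQ
  obtain ⟨ys', hys', hreg', hlen'⟩ := hF.exists_isWeaklyRegular_length_eq_height hQ'.ne_top
  obtain ⟨ys, rfl⟩ : ∃ ys : List S, ys.map π = ys' :=
    ⟨ys'.map (Function.surjInv Ideal.Quotient.mk_surjective), by
      rw [List.map_map, Function.RightInverse.comp_eq_id
        (Function.surjInv_eq Ideal.Quotient.mk_surjective), List.map_id]⟩
  have hys : ∀ y ∈ ys, y ∈ Q := fun y hy ↦ by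
    rw [← Ideal.mem_quotient_iff_mem hpQ]
    exact hys' _ (List.mem_map_of_mem hy)
  obtain ⟨n, hn⟩ : ∃ n : ℕ, p ^ n ≤ Ideal.ofList rs := by
    -- a prime containing `rs` has height at least `rs.length = ht p`, so it is `p`
    have hrad : p ≤ (Ideal.ofList rs).radical := by
      rw [Ideal.radical_eq_sInf]
      refine le_sInf fun P hP ↦ ?_
      have := hP.2
      refine (Ideal.eq_of_le_of_height_le P (IsLocalRing.le_maximalIdeal hP.2.ne_top) ?_).ge
      rw [← hlen]
      exact hreg.length_le_height fun r hr ↦ hP.1 (Ideal.subset_span hr)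
    obtain ⟨n, hn⟩ := (Ideal.ofList rs).exists_radical_pow_le_of_fg
      (IsNoetherian.noetherian _)
    exact ⟨n, (Ideal.pow_right_mono hrad n).trans hn⟩
  have hall : IsWeaklyRegular S (rs.map (algebraMap R S) ++ ys) := by
    rw [isWeaklyRegular_append_iff]
    refine ⟨hreg.of_flat, ?_⟩
    have h1 : IsWeaklyRegular (S ⧸ p.map (algebraMap R S)) ys :=
      (isWeaklyRegular_map_algebraMap_iff ..).mp hreg'
    have h2 := h1.tensor_of_pow_le_annihilator (E := R ⧸ Ideal.ofList rs) (n := n)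
      (by rwa [Ideal.annihilator_quotient])
    rw [← Ideal.map_ofList, smul_eq_mul, Ideal.mul_top]
    exact ((Algebra.TensorProduct.quotIdealMapEquivTensorQuot S
      (Ideal.ofList rs)).toLinearEquiv.isWeaklyRegular_congr ys).mpr h2
  calc Q.height ≤ p.height + (Q.map π).height := Ideal.height_le_height_add_of_liesOver p Q
    _ = ((rs.map (algebraMap R S) ++ ys).length : ℕ∞) := by
      rw [← hlen, ← hlen']
      simp
    _ ≤ Q.regularGrade := Ideal.length_le_regularGrade hQ.ne_top (fun r hr ↦ by
      rcases List.mem_append.mp hr with hr | hr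
      · obtain ⟨x, hx, rfl⟩ := List.mem_map.mp hr
        exact hpQ (Ideal.mem_map_of_mem _ (hrs x hx))
      · exact hys r hr) hall

namespace IsCohenMacaulayRing

theorem localization {R S : Type*} [CommRing R] [CommRing S] [Algebra R S]
    (hR : IsCohenMacaulayRing R) (W : Submonoid R) [IsLocalization W S] :
    IsCohenMacaulayRing S := by
  have := hR.isNoetherianRing
  have := IsLocalization.isNoetherianRing W S inferInstance
  refine of_height_le fun m hm ↦ ?_
  have hne : m.under R ≠ ⊤ := (Ideal.IsPrime.under R m).ne_top
  obtain ⟨rs, hrs, hreg, hlen⟩ := hR.exists_isWeaklyRegular_length_eq_height hne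
  have := Ideal.length_le_regularGrade hm.ne_top (by simpa using hrs) (hreg.of_isLocalization S W)
  rwa [List.length_map, hlen, IsLocalization.height_under W] at this

attribute [local instance] Algebra.TensorProduct.rightAlgebra in
/-- A Noetherian flat algebra over a Cohen-Macaulay ring is Cohen-Macaulay as soon as its fibres
are. -/
theorem of_flat_of_fiber {R S : Type*} [CommRing R] [CommRing S] [IsNoetherianRing S] [Algebra R S]
    [Module.Flat R S] (hR : IsCohenMacaulayRing R)
    (hF : ∀ (p : Ideal R) [p.IsPrime], IsCohenMacaulayRing (p.Fiber S)) :
    IsCohenMacaulayRing S := by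
  refine of_height_le fun m hm ↦ ?_
  let p := m.under R
  let Rp := Localization.AtPrime p
  let T := Rp ⊗[R] S
  let W := Algebra.algebraMapSubmonoid S p.primeCompl
  have : IsLocalization W T := inferInstance
  have hT : IsNoetherianRing T := IsLocalization.isNoetherianRing W T inferInstance
  have hdisj : Disjoint (W : Set S) m := by
    rw [Set.disjoint_left]
    rintro _ ⟨r, hr, rfl⟩ hrm
    exact hr hrm
  let Q := m.map (algebraMap S T)
  have hQ : Q.IsPrime := IsLocalization.isPrime_of_isPrime_disjoint W T m hm.isPrime hdisj
  have hQm : Q.under S = m := IsLocalization.under_map_of_isPrime_disjoint W T hm.isPrime hdisj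
  have hQmax : (Q.under S).IsMaximal := by rwa [hQm]
  have hover : Q.LiesOver (IsLocalRing.maximalIdeal Rp) := by
    refine ⟨?_⟩
    rw [← IsLocalization.map_under p.primeCompl Rp (Q.under Rp), Ideal.under_under,
      ← Ideal.under_under (B := S), hQm]
    exact (Localization.AtPrime.map_eq_maximalIdeal (I := p)).symm
  have hRp : IsCohenMacaulayRing Rp := hR.localization p.primeCompl
  have hfib : IsCohenMacaulayRing (T ⧸ (IsLocalRing.maximalIdeal Rp).map (algebraMap Rp T)) := by
    refine (hF p).of_ringEquiv (RingEquiv.symm ?_)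
    exact ((Algebra.TensorProduct.quotIdealMapEquivQuotTensor T
      (IsLocalRing.maximalIdeal Rp)).toRingEquiv).trans
      (Algebra.TensorProduct.cancelBaseChange R Rp Rp p.ResidueField S).toRingEquiv
  have := Ideal.height_le_regularGrade_of_flat_of_isLocalRing hRp hfib Q
  rwa [← IsLocalization.regularGrade_under W Q hQ.ne_top, ← IsLocalization.height_under W Q,
    hQm] at this

end IsCohenMacaulayRing

/-! ### Polynomial rings -/

namespace IsCohenMacaulayRing

theorem of_isPrincipalIdealRing (R : Type*) [CommRing R] [IsDomain R] [IsPrincipalIdealRing R] :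
    IsCohenMacaulayRing R := by
  refine of_height_le fun m hm ↦ ?_
  obtain rfl | hbot := eq_or_ne m ⊥
  · simp
  · obtain ⟨x, hxm, hx0⟩ := m.ne_bot_iff.mp hbot
    have hreg : IsWeaklyRegular R [x] := by
      rw [isWeaklyRegular_singleton_iff]
      exact (isRegular_iff_ne_zero.mpr hx0).left.isSMulRegular
    calc m.height ≤ 1 :=
          Ideal.height_le_one_of_isPrincipal_of_mem_minimalPrimes m m
            (by rw [Ideal.minimalPrimes_eq_subsingleton_self]; rfl)
      _ = ([x].length : ℕ∞) := by simp
      _ ≤ m.regularGrade := Ideal.length_le_regularGrade hm.ne_top (by simpa using hxm) hreg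

theorem polynomial {R : Type*} [CommRing R] (hR : IsCohenMacaulayRing R) :
    IsCohenMacaulayRing (Polynomial R) := by
  have := hR.isNoetherianRing
  refine hR.of_flat_of_fiber fun p _ ↦ ?_
  exact (of_isPrincipalIdealRing (Polynomial p.ResidueField)).of_ringEquiv
    (polyEquivTensor R p.ResidueField).toRingEquiv

theorem mvPolynomial {R : Type*} [CommRing R] (hR : IsCohenMacaulayRing R) (n : ℕ) :
    IsCohenMacaulayRing (MvPolynomial (Fin n) R) := by
  induction n with
  | zero => exact hR.of_ringEquiv (MvPolynomial.isEmptyRingEquiv R (Fin 0)).symm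
  | succ n ih => exact ih.polynomial.of_ringEquiv (MvPolynomial.finSuccEquiv R n).symm.toRingEquiv

end IsCohenMacaulayRing

/-! ### Base change along field extensions -/

/-- If `Q` is generated by elements that are integral over `R`, then `Q` is a minimal prime over
the extension of its contraction `N`, so that `ht Q ≤ ht N`, while regular sequences in `N` stay
weakly regular under the flat map. -/
theorem Ideal.height_le_regularGrade_of_flat_of_isIntegral {R S : Type*} [CommRing R]
    [CommRing S] [IsNoetherianRing S] [Algebra R S] [Module.Flat R S] (hR : IsCohenMacaulayRing R)
    (Q : Ideal S) [hQ : Q.IsPrime] {s : Set S} (hs : Ideal.span s = Q)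
    (hint : ∀ x ∈ s, IsIntegral R x) : Q.height ≤ Q.regularGrade := by
  have := hR.isNoetherianRing
  have hN : (Q.under R).IsPrime := inferInstance
  have hle : (Q.under R).map (algebraMap R S) ≤ Q := Ideal.map_comap_le
  set π := Ideal.Quotient.mk ((Q.under R).map (algebraMap R S))
  have hQ' : (Q.map π).IsPrime := Ideal.isPrime_map_quotientMk_of_isPrime hle
  have hzero : (Q.map π).height = 0 := by
    rw [Ideal.height_eq_zero_iff]
    refine ⟨⟨hQ', bot_le⟩, fun P hP hPQ ↦ ?_⟩
    have := hP.1
    have hcomap : P.comap π ≤ Q := by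
      refine (Ideal.comap_mono hPQ).trans_eq ?_
      rw [Ideal.comap_map_of_surjective' _ Ideal.Quotient.mk_surjective, Ideal.mk_ker,
        sup_eq_left.mpr hle]
    rw [Ideal.map_le_iff_le_comap]
    conv_lhs => rw [← hs]
    rw [Ideal.span_le]
    intro x hx
    by_contra hxP
    refine (Ideal.comap_lt_comap_of_integral_mem_sdiff hcomap
      ⟨hs ▸ Ideal.subset_span hx, hxP⟩ (hint x hx)).not_ge ?_
    refine Ideal.map_le_iff_le_comap.mp ?_
    conv_lhs => rw [← Ideal.mk_ker (I := (Q.under R).map (algebraMap R S))]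
    exact Ideal.comap_mono bot_le
  obtain ⟨rs, hrs, hreg, hlen⟩ := hR.exists_isWeaklyRegular_length_eq_height hN.ne_top
  calc Q.height ≤ (Q.under R).height + (Q.map π).height :=
        Ideal.height_le_height_add_of_liesOver (Q.under R) Q
    _ = ((rs.map (algebraMap R S)).length : ℕ∞) := by rw [hzero, add_zero, ← hlen, List.length_map]
    _ ≤ Q.regularGrade := Ideal.length_le_regularGrade hQ.ne_top (by simpa using hrs) hreg.of_flat

theorem RingHom.Flat.of_injective_field {R K : Type*} [CommRing R] [Field K] {f : R →+* K}
    (hf : Function.Injective f) : f.Flat := by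
  algebraize [f]
  have : FaithfulSMul R K := (faithfulSMul_iff_algebraMap_injective R K).mpr hf
  have := IsDomain.of_faithfulSMul R K
  let := FractionRing.liftAlgebra R K
  exact Module.Flat.trans R (FractionRing R) K

theorem Algebra.TensorProduct.isIntegralElem_map_id {k P K B : Type*} [CommRing k] [CommRing P]
    [Algebra k P] [CommRing K] [Algebra k K] [CommRing B] [Algebra k B] (φ : P →ₐ[k] K) {a : K}
    (ha : φ.toRingHom.IsIntegralElem a) (b : B) :
    (Algebra.TensorProduct.map φ (AlgHom.id k B)).toRingHom.IsIntegralElem (a ⊗ₜ[k] b) := by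
  set f := (Algebra.TensorProduct.map φ (AlgHom.id k B)).toRingHom
  have h1 : f.IsIntegralElem (a ⊗ₜ[k] (1 : B)) := by
    obtain ⟨p, hp, hpa⟩ := ha
    refine ⟨p.map (Algebra.TensorProduct.includeLeftRingHom : P →+* P ⊗[k] B), hp.map _, ?_⟩
    have hcomp : f.comp (Algebra.TensorProduct.includeLeftRingHom : P →+* P ⊗[k] B) =
        (Algebra.TensorProduct.includeLeftRingHom : K →+* K ⊗[k] B).comp φ.toRingHom := by
      ext; simp [f]
    have hinc : a ⊗ₜ[k] (1 : B) = (Algebra.TensorProduct.includeLeftRingHom : K →+* K ⊗[k] B) a :=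
      rfl
    rw [Polynomial.eval₂_map, hcomp, hinc, ← Polynomial.hom_eval₂, hpa, map_zero]
  have h2 : f.IsIntegralElem ((1 : K) ⊗ₜ[k] b) := by
    have : (1 : K) ⊗ₜ[k] b = f (1 ⊗ₜ b) := by simp [f]
    rw [this]
    exact f.isIntegralElem_map
  simpa using h1.mul f h2

/-- Finitely many elements of `K ⊗ B` are integral over a polynomial ring over `B` over which
`K ⊗ B` is flat: their coefficients in `K` generate a finitely generated `k`-algebra, to which
Noether normalization applies. -/
theorem TensorProduct.exists_flat_mvPolynomial_isIntegral (k K B : Type*) [Field k] [Field K]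
    [Algebra k K] [CommRing B] [Algebra k B] (s : Finset (K ⊗[k] B)) :
    ∃ (n : ℕ) (f : MvPolynomial (Fin n) k ⊗[k] B →+* K ⊗[k] B), f.Flat ∧
      ∀ x ∈ s, f.IsIntegralElem x := by
  classical
  choose S hS using fun x : K ⊗[k] B ↦ TensorProduct.exists_finset x
  let c : Finset K := s.biUnion fun x ↦ (S x).image Prod.fst
  have : Algebra.FiniteType k (Algebra.adjoin k (c : Set K)) :=
    (Subalgebra.fg_iff_finiteType _).mp ⟨c, rfl⟩
  obtain ⟨n, g, hg, hint⟩ := exists_integral_inj_algHom_of_fg k (Algebra.adjoin k (c : Set K))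
  let φ : MvPolynomial (Fin n) k →ₐ[k] K := (Algebra.adjoin k (c : Set K)).val.comp g
  have hφ : Function.Injective φ := Subtype.val_injective.comp hg
  have hφc : ∀ a ∈ c, φ.toRingHom.IsIntegralElem a := by
    intro a ha
    obtain ⟨p, hp, hpa⟩ := hint ⟨a, Algebra.subset_adjoin ha⟩
    refine ⟨p, hp, ?_⟩
    have := congrArg (Algebra.adjoin k (c : Set K)).val.toRingHom hpa
    rwa [Polynomial.hom_eval₂, map_zero] at this
  have hflat : (Algebra.TensorProduct.map φ (AlgHom.id k B)).toRingHom.Flat :=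
    RingHom.Flat.tensorProductMap (f := φ) (g := AlgHom.id k B)
      (RingHom.Flat.of_injective_field (f := φ.toRingHom) hφ) (.id B)
  refine ⟨n, (Algebra.TensorProduct.map φ (AlgHom.id k B)).toRingHom, hflat, fun x hx ↦ ?_⟩
  rw [hS x]
  refine Finset.sum_induction _ _ (fun _ _ ↦ RingHom.IsIntegralElem.add _)
    (RingHom.isIntegralElem_zero _) fun i hi ↦ ?_
  exact Algebra.TensorProduct.isIntegralElem_map_id φ (hφc _ (Finset.mem_biUnion.mpr
    ⟨x, hx, Finset.mem_image_of_mem _ hi⟩)) _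

theorem IsCohenMacaulayRing.tensorProduct_field {k K B : Type*} [Field k] [Field K] [Algebra k K]
    [CommRing B] [Algebra k B] [IsNoetherianRing (K ⊗[k] B)] (hB : IsCohenMacaulayRing B) :
    IsCohenMacaulayRing (K ⊗[k] B) := by
  refine of_height_le fun Q hQ ↦ ?_
  obtain ⟨s, hs⟩ := (IsNoetherian.noetherian Q : Q.FG)
  obtain ⟨n, f, hf, hint⟩ := TensorProduct.exists_flat_mvPolynomial_isIntegral k K B s
  have hV : IsCohenMacaulayRing (MvPolynomial (Fin n) k ⊗[k] B) :=
    (hB.mvPolynomial n).of_ringEquiv <|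
      (MvPolynomial.algebraTensorAlgEquiv k B).symm.toRingEquiv.trans
        (Algebra.TensorProduct.comm k B _).toRingEquiv
  let := f.toAlgebra
  have : Module.Flat (MvPolynomial (Fin n) k ⊗[k] B) (K ⊗[k] B) := hf
  exact Ideal.height_le_regularGrade_of_flat_of_isIntegral hV Q hs hint

/-! ### Noetherian descent and heights along flat maps -/

theorem isNoetherianRing_of_faithfullyFlat (R S : Type*) [CommRing R] [CommRing S] [Algebra R S]
    [Module.FaithfullyFlat R S] [IsNoetherianRing S] : IsNoetherianRing R := by
  rw [isNoetherianRing_iff, isNoetherian_iff']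
  have : WellFoundedGT (Ideal S) := inferInstance
  refine StrictMono.wellFoundedGT (f := Ideal.map (algebraMap R S)) fun I J hIJ ↦ ?_
  refine lt_of_le_of_ne (Ideal.map_mono hIJ.le) fun h ↦ hIJ.ne ?_
  rw [← Ideal.comap_map_eq_self_of_faithfullyFlat (B := S) I, h,
    Ideal.comap_map_eq_self_of_faithfullyFlat]

theorem Ideal.height_under_le_of_flat {R S : Type*} [CommRing R] [IsNoetherianRing R] [CommRing S]
    [IsNoetherianRing S] [Algebra R S] [Module.Flat R S] (Q : Ideal S) [Q.IsPrime] :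
    (Q.under R).height ≤ Q.height := by
  rw [Ideal.height_eq_height_add_of_liesOver_of_hasGoingDown (Q.under R) Q]
  exact le_self_add

instance Ideal.Fiber.isNoetherianRing {R S : Type*} [CommRing R] [CommRing S] [IsNoetherianRing S]
    [Algebra R S] (p : Ideal R) [p.IsPrime] : IsNoetherianRing (p.Fiber S) := by
  have : IsNoetherianRing (S ⊗[R] p.ResidueField) := Algebra.EssFiniteType.isNoetherianRing S _
  exact isNoetherianRing_of_ringEquiv _ (Algebra.TensorProduct.comm R S p.ResidueField).toRingEquiv

/-! ### Sums of extended ideals in a tensor product -/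

section TensorProduct

variable {k A B : Type*} [Field k] [CommRing A] [CommRing B] [Algebra k A] [Algebra k B]

theorem Ideal.tensorSum_eq_ker (I : Ideal A) (J : Ideal B) :
    I.tensorSum k J = RingHom.ker (Algebra.TensorProduct.map (Ideal.Quotient.mkₐ k I)
      (Ideal.Quotient.mkₐ k J)) := by
  rw [Algebra.TensorProduct.map_ker _ _ (Ideal.Quotient.mkₐ_surjective k I)
    (Ideal.Quotient.mkₐ_surjective k J), Ideal.tensorSum]
  congr 2 <;> exact (Ideal.Quotient.mkₐ_ker k _).symm

theorem Ideal.tmul_notMem_tensorSum {I : Ideal A} {J : Ideal B} {x : A} {y : B} (hx : x ∉ I)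
    (hy : y ∉ J) : x ⊗ₜ y ∉ I.tensorSum k J := by
  rw [Ideal.tensorSum_eq_ker, RingHom.mem_ker, Algebra.TensorProduct.map_tmul]
  intro h
  have hx' : Ideal.Quotient.mkₐ k I x ≠ 0 := fun h0 ↦ hx (Ideal.Quotient.eq_zero_iff_mem.mp h0)
  have hy' : Ideal.Quotient.mkₐ k J y ≠ 0 := fun h0 ↦ hy (Ideal.Quotient.eq_zero_iff_mem.mp h0)
  -- two linear forms that do not vanish on the factors detect the pure tensor
  rw [Ne, ← Module.forall_dual_apply_eq_zero_iff k, not_forall] at hx' hy'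
  obtain ⟨f, hf⟩ := hx'
  obtain ⟨g, hg⟩ := hy'
  have := congrArg ((TensorProduct.lid k k).toLinearMap ∘ₗ TensorProduct.map f g) h
  exact mul_ne_zero hf hg (by simpa using this)

theorem Ideal.tensorSum_ne_top {I : Ideal A} {J : Ideal B} (hI : I ≠ ⊤) (hJ : J ≠ ⊤) :
    I.tensorSum k J ≠ ⊤ := fun h ↦
  Ideal.tmul_notMem_tensorSum (k := k) ((Ideal.ne_top_iff_one I).mp hI)
    ((Ideal.ne_top_iff_one J).mp hJ) (h ▸ trivial)

theorem Ideal.mul_tmul_mem_tensorSum {I I' : Ideal A} {J J' : Ideal B} {x : A} {y : B}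
    (hx : ∀ a ∈ I, a * x ∈ I') (hy : ∀ b ∈ J, b * y ∈ J') {z : A ⊗[k] B}
    (hz : z ∈ I.tensorSum k J) : z * x ⊗ₜ y ∈ I'.tensorSum k J' := by
  suffices h : I.tensorSum k J ≤ (I'.tensorSum k J').colon {x ⊗ₜ y} from
    Submodule.mem_colon_singleton.mp (h hz)
  refine sup_le (Ideal.map_le_iff_le_comap.mpr fun a ha ↦ ?_)
    (Ideal.map_le_iff_le_comap.mpr fun b hb ↦ ?_)
  · rw [Ideal.mem_comap, Submodule.mem_colon_singleton]
    have : (a * x) ⊗ₜ[k] (1 : B) ∈ I'.tensorSum k J' :=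
      Ideal.mem_sup_left (Ideal.mem_map_of_mem _ (hx a ha))
    simpa using Ideal.mul_mem_left _ (1 ⊗ₜ y) this
  · rw [Ideal.mem_comap, Submodule.mem_colon_singleton]
    have : (1 : A) ⊗ₜ[k] (b * y) ∈ I'.tensorSum k J' :=
      Ideal.mem_sup_right (Ideal.mem_map_of_mem _ (hy b hb))
    simpa using Ideal.mul_mem_left _ (x ⊗ₜ 1) this

/-- The quotient of `A ⊗ B` by the extension of `I` is `B ⊗ (A / I)`; the order of the factors
makes it a `B`-algebra. -/
theorem TensorProduct.exists_quotient_map_includeLeft_ringEquiv (I : Ideal A) :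
    ∃ e : ((A ⊗[k] B) ⧸ I.map (algebraMap A (A ⊗[k] B))) ≃+* B ⊗[k] (A ⧸ I),
      ∀ b : B, e (Ideal.Quotient.mk _ (1 ⊗ₜ b)) = algebraMap B _ b := by
  let f : A ⊗[k] B →ₐ[k] B ⊗[k] (A ⧸ I) :=
    (Algebra.TensorProduct.comm k (A ⧸ I) B).toAlgHom.comp
      (Algebra.TensorProduct.map (Ideal.Quotient.mkₐ k I) (AlgHom.id k B))
  have hf : Function.Surjective f :=
    (Algebra.TensorProduct.comm k (A ⧸ I) B).surjective.comp
      (TensorProduct.map_surjective (Ideal.Quotient.mkₐ_surjective k I) Function.surjective_id)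
  have hker : I.map (algebraMap A (A ⊗[k] B)) = RingHom.ker f := by
    ext z
    rw [RingHom.mem_ker, AlgHom.comp_apply, AlgEquiv.coe_toAlgHom,
      EmbeddingLike.map_eq_zero_iff, ← RingHom.mem_ker,
      Algebra.TensorProduct.rTensor_ker _ (Ideal.Quotient.mkₐ_surjective k I),
      show RingHom.ker (Ideal.Quotient.mkₐ k I) = I from Ideal.Quotient.mkₐ_ker k I]
    rfl
  refine ⟨(Ideal.quotientEquivAlgOfEq k hker).toRingEquiv.trans
    (RingHom.quotientKerEquivOfSurjective hf), fun b ↦ ?_⟩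
  change f (1 ⊗ₜ b) = _
  simp [f]

theorem RingTheory.Sequence.IsWeaklyRegular.append_tensorProduct {rs : List A} {ss : List B}
    (hrs : IsWeaklyRegular A rs) (hss : IsWeaklyRegular B ss) :
    IsWeaklyRegular (A ⊗[k] B) (rs.map (algebraMap A (A ⊗[k] B)) ++
      ss.map (Algebra.TensorProduct.includeRight : B →ₐ[k] A ⊗[k] B)) := by
  rw [isWeaklyRegular_append_iff]
  refine ⟨hrs.of_flat, ?_⟩
  obtain ⟨e, he⟩ :=
    TensorProduct.exists_quotient_map_includeLeft_ringEquiv (k := k) (B := B) (Ideal.ofList rs)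
  rw [← Ideal.map_ofList, smul_eq_mul, Ideal.mul_top]
  have h := hss.of_flat (S := B ⊗[k] (A ⧸ Ideal.ofList rs))
  refine (e.toAddEquiv.isWeaklyRegular_congr ?_).mpr h
  rw [List.forall₂_map_left_iff, List.forall₂_map_right_iff, List.forall₂_same]
  intro b _ x
  obtain ⟨x, rfl⟩ := Ideal.Quotient.mk_surjective x
  have : (Algebra.TensorProduct.includeRight : B →ₐ[k] A ⊗[k] B) b •
      Ideal.Quotient.mk ((Ideal.ofList rs).map (algebraMap A (A ⊗[k] B))) x =
      Ideal.Quotient.mk _ (1 ⊗ₜ b) * Ideal.Quotient.mk _ x := rfl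
  rw [this]
  exact (map_mul e _ _).trans (by rw [he, smul_eq_mul]; rfl)

variable (k A B) in
theorem TensorProduct.isNoetherianRing_left [IsNoetherianRing (A ⊗[k] B)] [Nontrivial B] : IsNoetherianRing A :=
  isNoetherianRing_of_faithfullyFlat A (A ⊗[k] B)

variable (k A B) in
theorem TensorProduct.isNoetherianRing_right [IsNoetherianRing (A ⊗[k] B)] [Nontrivial A] : IsNoetherianRing B :=
  have : IsNoetherianRing (B ⊗[k] A) :=
    isNoetherianRing_of_ringEquiv _ (Algebra.TensorProduct.comm k A B).toRingEquiv
  isNoetherianRing_of_faithfullyFlat B (B ⊗[k] A)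

variable [IsNoetherianRing (A ⊗[k] B)]

/-- Concatenating maximal regular sequences of `I` and `J` gives one of `I ⊗ B + A ⊗ J`: if `I`
kills `x` modulo the first and `J` kills `y` modulo the second, `I ⊗ B + A ⊗ J` kills `x ⊗ y`. -/
theorem Ideal.regularGrade_tensorSum {I : Ideal A} {J : Ideal B} (hI : I ≠ ⊤) (hJ : J ≠ ⊤) :
    (I.tensorSum k J).regularGrade = I.regularGrade + J.regularGrade := by
  have : Nontrivial A := ⟨0, 1, fun h ↦ (Ideal.ne_top_iff_one I).mp hI (h ▸ I.zero_mem)⟩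
  have : Nontrivial B := ⟨0, 1, fun h ↦ (Ideal.ne_top_iff_one J).mp hJ (h ▸ J.zero_mem)⟩
  have : IsNoetherianRing A := TensorProduct.isNoetherianRing_left k A B
  have : IsNoetherianRing B := TensorProduct.isNoetherianRing_right k A B
  obtain ⟨rs, hrs, hreg, hlen, x, hx, hIx⟩ :=
    Ideal.exists_isWeaklyRegular_length_eq_regularGrade hI
  obtain ⟨ss, hss, hreg', hlen', y, hy, hJy⟩ :=
    Ideal.exists_isWeaklyRegular_length_eq_regularGrade hJ
  have hlist : Ideal.ofList (rs.map (algebraMap A (A ⊗[k] B)) ++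
      ss.map (Algebra.TensorProduct.includeRight : B →ₐ[k] A ⊗[k] B)) =
      (Ideal.ofList rs).tensorSum k (Ideal.ofList ss) := by
    rw [Ideal.ofList_append, ← Ideal.map_ofList]
    congr 1
    exact (Ideal.map_ofList (Algebra.TensorProduct.includeRight : B →ₐ[k] A ⊗[k] B).toRingHom
      ss).symm
  rw [Ideal.regularGrade_eq_length_of_notMem_ofList (Ideal.tensorSum_ne_top hI hJ) ?_
    (hreg.append_tensorProduct (k := k) hreg') (y := x ⊗ₜ y) ?_ ?_, ← hlen, ← hlen']
  · simp
  · intro r hr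
    rcases List.mem_append.mp hr with hr | hr
    · obtain ⟨a, ha, rfl⟩ := List.mem_map.mp hr
      exact Ideal.mem_sup_left (Ideal.mem_map_of_mem _ (hrs a ha))
    · obtain ⟨b, hb, rfl⟩ := List.mem_map.mp hr
      exact Ideal.mem_sup_right (Ideal.mem_map_of_mem _ (hss b hb))
  · rw [hlist]
    exact Ideal.tmul_notMem_tensorSum hx hy
  · intro z hz
    rw [hlist]
    exact Ideal.mul_tmul_mem_tensorSum hIx hJy hz

/-- For a prime `Q` containing `p ⊗ B + A ⊗ q`, flatness over `A` bounds `ht Q` below by the sum of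
the heights of the contraction `p'` of `Q` to `A` and of `Q / p'`; the latter is at least `ht q`
because `(A / p') ⊗ B` is flat over `B`. -/
theorem Ideal.height_add_height_le_height_tensorSum (p : Ideal A) (q : Ideal B) :
    p.height + q.height ≤ (p.tensorSum k q).height := by
  rw [(p.tensorSum k q).height_eq_inf_minimalPrimes]
  refine le_iInf₂ fun Q hQ ↦ ?_
  have := hQ.1.1
  have : Nontrivial (A ⊗[k] B) :=
    ⟨0, 1, fun h ↦ this.ne_top ((Ideal.eq_top_iff_one _).mpr (h ▸ Q.zero_mem))⟩
  have : Nontrivial A := (algebraMap A (A ⊗[k] B)).domain_nontrivial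
  have : Nontrivial B :=
    (Algebra.TensorProduct.includeRight : B →ₐ[k] A ⊗[k] B).toRingHom.domain_nontrivial
  have : IsNoetherianRing A := TensorProduct.isNoetherianRing_left k A B
  have : IsNoetherianRing B := TensorProduct.isNoetherianRing_right k A B
  let p' := Q.under A
  have hle : p'.map (algebraMap A (A ⊗[k] B)) ≤ Q := Ideal.map_comap_le
  have hpp' : p ≤ p' := Ideal.map_le_iff_le_comap.mp (le_sup_left.trans hQ.1.2)
  obtain ⟨e, he⟩ :=
    TensorProduct.exists_quotient_map_includeLeft_ringEquiv (k := k) (B := B) p'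
  have : IsNoetherianRing (B ⊗[k] (A ⧸ p')) := isNoetherianRing_of_ringEquiv _ e
  have hQ' : (Q.map (Ideal.Quotient.mk (p'.map (algebraMap A (A ⊗[k] B))))).IsPrime :=
    Ideal.isPrime_map_quotientMk_of_isPrime hle
  set Q₁ := Q.map (Ideal.Quotient.mk (p'.map (algebraMap A (A ⊗[k] B))))
  have hQ₂ : (Q₁.map e).IsPrime := Ideal.map_isPrime_of_equiv e
  have hq : q ≤ (Q₁.map e).under B := by
    intro b hb
    rw [Ideal.under_def, Ideal.mem_comap, ← he]
    refine Ideal.mem_map_of_mem _ (Ideal.mem_map_of_mem _ (hQ.1.2 ?_))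
    exact Ideal.mem_sup_right (Ideal.mem_map_of_mem _ hb)
  calc p.height + q.height ≤ p'.height + (Q₁.map e).height := by
        gcongr
        exact (Ideal.height_mono hq).trans (Ideal.height_under_le_of_flat _)
    _ = p'.height + Q₁.height := by rw [e.height_map]
    _ = Q.height := (Ideal.height_eq_height_add_of_liesOver_of_hasGoingDown p' Q).symm

theorem IsCohenMacaulayRing.tensorProduct (hA : IsCohenMacaulayRing A)
    (hB : IsCohenMacaulayRing B) : IsCohenMacaulayRing (A ⊗[k] B) := by
  refine hA.of_flat_of_fiber fun p _ ↦ ?_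
  let e : p.Fiber (A ⊗[k] B) ≃+* p.ResidueField ⊗[k] B :=
    (Algebra.TensorProduct.cancelBaseChange k A p.ResidueField p.ResidueField B).toRingEquiv
  have : IsNoetherianRing (p.ResidueField ⊗[k] B) :=
    isNoetherianRing_of_ringEquiv (p.Fiber (A ⊗[k] B)) e
  exact (hB.tensorProduct_field (k := k) (K := p.ResidueField)).of_ringEquiv e.symm

end TensorProduct

end

theorem theorem2p1 {k A B : Type*} [Field k] [CommRing A] [CommRing B] [Algebra k A]
    [Algebra k B] [Nontrivial A] [Nontrivial B] [IsNoetherianRing (TensorProduct k A B)] :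
    List.TFAE [
      IsCohenMacaulayRing (TensorProduct k A B),
      ∀ (I : Ideal A) (J : Ideal B), I ≠ ⊤ → J ≠ ⊤ →
        (I.tensorSum k J).regularGrade = (I.tensorSum k J).height,
      ∀ (p : Ideal A) (q : Ideal B), p.IsPrime → q.IsPrime →
        (p.tensorSum k q).regularGrade = (p.tensorSum k q).height,
      IsCohenMacaulayRing A ∧ IsCohenMacaulayRing B] := by
  have hAn : IsNoetherianRing A := TensorProduct.isNoetherianRing_left k A B
  have hBn : IsNoetherianRing B := TensorProduct.isNoetherianRing_right k A B
  tfae_have 1 → 2 := fun h I J hI hJ ↦ h.regularGrade_eq_height (Ideal.tensorSum_ne_top hI hJ)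
  tfae_have 2 → 3 := fun h p q hp hq ↦ h p q hp.ne_top hq.ne_top
  tfae_have 3 → 4 := by
    intro h
    have key : ∀ (p : Ideal A) (q : Ideal B), p.IsMaximal → q.IsMaximal →
        p.regularGrade = p.height ∧ q.regularGrade = q.height := by
      intro p q hp hq
      have hle := Ideal.height_add_height_le_height_tensorSum (k := k) p q
      rw [← h p q hp.isPrime hq.isPrime, Ideal.regularGrade_tensorSum hp.ne_top hq.ne_top] at hle
      have hp' := p.regularGrade_le_height
      have hq' := q.regularGrade_le_height
      have hpt := Ideal.height_ne_top hp.ne_top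
      have hqt := Ideal.height_ne_top hq.ne_top
      refine ⟨le_antisymm hp' ?_, le_antisymm hq' ?_⟩
      · exact (ENat.add_le_add_iff_right hqt).mp (hle.trans (by gcongr))
      · exact (ENat.add_le_add_iff_left hpt).mp (hle.trans (by gcongr))
    obtain ⟨p₀, hp₀⟩ := Ideal.exists_maximal A
    obtain ⟨q₀, hq₀⟩ := Ideal.exists_maximal B
    exact ⟨⟨hAn, fun p hp ↦ (key p q₀ hp hq₀).1⟩, ⟨hBn, fun q hq ↦ (key p₀ q hp₀ hq).2⟩⟩
  tfae_have 4 → 1 := fun h ↦ h.1.tensorProduct h.2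
  tfae_finish
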